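/- Let $R$ be a finite-dimensional solvable Lie algebra over $\mathbb{C}$, let $N$ be its nilradical (the largest nilpotent ideal), and let $Q$ be a vector-space complement of $N$ in $R$, so that $R = N \oplus Q$ as vector spaces. Write $N^2 = [N,N]$. Assume that $N$ has maximal rank in the following sense: there exists a finite-dimensional complex solvable Lie algebra $S$ whose nilradical is isomorphic, as a Lie algebra, to $N$ and has a vector-space complement in $S$ of dimension $\dim (N/N^2)$. If $\dim Q < \dim (N/N^2)$, then $R$ has an outer derivation, that is, a derivation $D : R \to R$ which is not of the form $\operatorname{ad}_x$ for any $x \in R$. -/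

import Mathlib

/-!
Suppose every derivation of `R` is inner. The semisimple part of a Cartan subalgebra of `R` acts by
derivations, hence by elements of an abelian subspace `T` with `R = N + T`, and `ad T ⊆ ℂ[ad t]` for
a generic `t` in `T`. On `N / N²` the algebra `R` acts through `R / N`, faithfully, and by
polynomials in the semisimple operator `ρ(t)`.

Maximal rank says that the image of `Der N` in `End (N / N²)` contains all diagonal matrices with
respect to some basis. A space of matrices containing the diagonal ones and closed under commutators
is also closed under products, so this image is an associative algebra `A ∋ ρ(t)`. As
`dim ρ(R) = dim Q < dim N / N²`, the centralizer of `ρ(t)` in `A` cannot lie in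
`ρ(R) ⊆ ℂ[ρ(t)]`. An element of it outside `ρ(R)` lifts, `ad t` being semisimple on `Der N`, to a
derivation of `N` commuting with `t`; extended by zero along a complement of `N` inside `T` it is a
derivation of `R` that is not inner.
-/

universe u v

/-- The nilradical of a Lie algebra: the sum of all ideals that are nilpotent as Lie algebras
(for a finite-dimensional Lie algebra, its largest nilpotent ideal). Mathlib's
`LieAlgebra.maxNilpotentIdeal` is different: it asks the whole algebra to act nilpotently on the
ideal. -/
def lieNilradical (L : Type u) [LieRing L] [LieAlgebra ℂ L] : LieIdeal ℂ L :=
  sSup { I : LieIdeal ℂ L | LieRing.IsNilpotent I }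

/-- The dimension of `N / N²`, where `N² = [N, N]`. -/
noncomputable def dimModSquare (N : Type u) [LieRing N] [LieAlgebra ℂ N] : ℕ :=
  Module.finrank ℂ (N ⧸ ⁅(⊤ : LieIdeal ℂ N), (⊤ : LieIdeal ℂ N)⁆)

/-- `N` has maximal rank: there is a finite-dimensional complex solvable Lie algebra `S` whose
nilradical is isomorphic to `N` and has a complementary subspace of dimension `dim N / N²`. -/
def HasMaximalRank (N : Type u) [LieRing N] [LieAlgebra ℂ N] : Prop :=
  ∃ (S : Type v) (_ : LieRing S) (_ : LieAlgebra ℂ S),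
    FiniteDimensional ℂ S ∧ LieAlgebra.IsSolvable S ∧
      Nonempty (N ≃ₗ⁅ℂ⁆ lieNilradical S) ∧
      ∃ Q : Submodule ℂ S, IsCompl (lieNilradical S).toSubmodule Q ∧
        Module.finrank ℂ Q = dimModSquare N

/-! ### Linear maps intertwining two endomorphisms -/

section Intertwining

open Polynomial

section Semiring

variable {K V W : Type*} [CommSemiring K] [AddCommMonoid V] [Module K V] [AddCommMonoid W]
  [Module K W] {π : V →ₗ[K] W} {f : Module.End K V} {g : Module.End K W}

theorem linearMap_ext_of_iSup_eq_top {ι : Type*} {p : ι → Submodule K V} (hp : ⨆ i, p i = ⊤)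
    {φ ψ : V →ₗ[K] W} (h : ∀ i, ∀ x ∈ p i, φ x = ψ x) : φ = ψ := by
  have hle : ⨆ i, p i ≤ LinearMap.eqLocus φ ψ := iSup_le h
  exact LinearMap.ext fun x ↦ (hp ▸ hle) (Submodule.mem_top (x := x))

theorem comp_aeval_eq_aeval_comp (h : π ∘ₗ f = g ∘ₗ π) (q : K[X]) :
    π ∘ₗ aeval f q = aeval g q ∘ₗ π := by
  induction q using Polynomial.induction_on' with
  | add p q hp hq => simp only [map_add, LinearMap.comp_add, LinearMap.add_comp, hp, hq]
  | monomial n a =>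
    have hpow : π ∘ₗ (f ^ n) = (g ^ n) ∘ₗ π :=
      Module.End.commute_pow_left_of_commute h.symm n |>.symm
    rw [aeval_monomial, aeval_monomial, ← Algebra.smul_def, ← Algebra.smul_def,
      LinearMap.comp_smul, LinearMap.smul_comp, hpow]

theorem mem_adjoin_singleton_of_injective_intertwiner {f' : Module.End K V} {g' : Module.End K W}
    (h : π ∘ₗ f = g ∘ₗ π) (h' : π ∘ₗ f' = g' ∘ₗ π) (hπ : Function.Injective π)
    (hg' : g' ∈ Algebra.adjoin K {g}) : f' ∈ Algebra.adjoin K {f} := by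
  rw [Algebra.adjoin_singleton_eq_range_aeval] at hg' ⊢
  obtain ⟨q, rfl⟩ := hg'
  exact ⟨q, (LinearMap.cancel_left hπ).mp ((comp_aeval_eq_aeval_comp h q).trans h'.symm)⟩

theorem mem_adjoin_singleton_of_surjective_intertwiner {f' : Module.End K V} {g' : Module.End K W}
    (h : π ∘ₗ f = g ∘ₗ π) (h' : π ∘ₗ f' = g' ∘ₗ π) (hπ : Function.Surjective π)
    (hf' : f' ∈ Algebra.adjoin K {f}) : g' ∈ Algebra.adjoin K {g} := by
  rw [Algebra.adjoin_singleton_eq_range_aeval] at hf' ⊢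
  obtain ⟨q, rfl⟩ := hf'
  exact ⟨q, (LinearMap.cancel_right hπ).mp ((comp_aeval_eq_aeval_comp h q).symm.trans h')⟩

end Semiring

variable {K V W : Type*} [Field K] [AddCommGroup V] [Module K V] [AddCommGroup W] [Module K W]
  {π : V →ₗ[K] W} {f : Module.End K V} {g : Module.End K W}

theorem isSemisimple_of_injective_intertwiner [FiniteDimensional K W] (h : π ∘ₗ f = g ∘ₗ π)
    (hπ : Function.Injective π) (hg : g.IsSemisimple) : f.IsSemisimple := by
  refine Module.End.isSemisimple_of_squarefree_aeval_eq_zero hg.minpoly_squarefree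
    (LinearMap.ext fun x ↦ hπ ?_)
  rw [← LinearMap.comp_apply, comp_aeval_eq_aeval_comp h, minpoly.aeval]
  simp

theorem isSemisimple_of_surjective_intertwiner [FiniteDimensional K V] (h : π ∘ₗ f = g ∘ₗ π)
    (hπ : Function.Surjective π) (hf : f.IsSemisimple) : g.IsSemisimple := by
  refine Module.End.isSemisimple_of_squarefree_aeval_eq_zero hf.minpoly_squarefree
    (LinearMap.ext fun y ↦ ?_)
  obtain ⟨x, rfl⟩ := hπ y
  rw [← LinearMap.comp_apply, ← comp_aeval_eq_aeval_comp h, minpoly.aeval]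
  simp

theorem hasEigenvalue_of_surjective_intertwiner [FiniteDimensional K V] (h : π ∘ₗ f = g ∘ₗ π)
    (hπ : Function.Surjective π) {μ : K} (hμ : g.HasEigenvalue μ) : f.HasEigenvalue μ := by
  have : FiniteDimensional K W := Module.Finite.of_surjective π hπ
  rw [Module.End.hasEigenvalue_iff_isRoot] at hμ ⊢
  refine hμ.dvd (minpoly.dvd K g (LinearMap.ext fun y ↦ ?_))
  obtain ⟨x, rfl⟩ := hπ y
  rw [← LinearMap.comp_apply, ← comp_aeval_eq_aeval_comp h, minpoly.aeval]
  simp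

end Intertwining

section Characters

open LieAlgebra LieModule Module

attribute [local instance] LieRing.ofAssociativeRing

variable {K L : Type*} [Field K] [IsAlgClosed K] [CharZero K] [LieRing L] [LieAlgebra K L]
  [LieAlgebra.IsSolvable L]

variable (K L) in
theorem exists_lieCharacter_nontrivial_weightSpace (M : Type*) [AddCommGroup M] [Module K M]
    [LieRingModule L M] [LieModule K L M] [FiniteDimensional K M] [Nontrivial M] :
    ∃ χ : LieCharacter K L, Nontrivial (weightSpace M χ) := by
  obtain ⟨χ, hχ⟩ := exists_nontrivial_weightSpace_of_isSolvable K L M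
  obtain ⟨⟨m, hm⟩, hm0⟩ := exists_ne (0 : weightSpace M χ)
  rw [mem_weightSpace] at hm
  refine ⟨{ χ with map_lie' := fun {x y} ↦ ?_ }, hχ⟩
  have hxy : χ ⁅x, y⁆ • m = 0 := by
    rw [← hm, lie_lie, hm, hm, lie_smul, lie_smul, hm, hm, smul_comm, sub_self]
  rw [LieRing.of_associative_ring_bracket, mul_comm, sub_self]
  exact (smul_eq_zero.mp hxy).resolve_right fun h ↦ hm0 (Subtype.ext h)

theorem exists_lieCharacter_apply_eq_of_hasEigenvalue {M : Type*} [AddCommGroup M] [Module K M]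
    [LieRingModule L M] [LieModule K L M] [FiniteDimensional K M] {x : L} {μ : K}
    (hμ : (toEnd K L M x).HasEigenvalue μ) :
    ∃ χ : LieCharacter K L, χ x = μ ∧ ∀ y, (toEnd K L M y).HasEigenvalue (χ y) := by
  obtain ⟨v, hv⟩ := hμ.exists_hasEigenvector
  have : Nontrivial M := ⟨v, 0, hv.2⟩
  obtain ⟨χ, hχ⟩ := exists_lieCharacter_nontrivial_weightSpace K L M
  obtain ⟨⟨m, hm⟩, hm0⟩ := exists_ne (0 : weightSpace M χ)
  let P := weightSpace M χ
  by_cases hvP : v ∈ P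
  · refine ⟨χ, smul_left_injective K hv.2 ?_, fun y ↦ ?_⟩
    · exact ((mem_weightSpace χ v).mp hvP x).symm.trans hv.apply_eq_smul
    · exact Module.End.hasEigenvalue_of_hasEigenvector
        ⟨Module.End.mem_eigenspace_iff.mpr ((mem_weightSpace χ m).mp hm y),
          fun h ↦ hm0 (Subtype.ext h)⟩
  · have hquot : FiniteDimensional K (M ⧸ P) :=
      inferInstanceAs (FiniteDimensional K (M ⧸ P.toSubmodule))
    have : finrank K (M ⧸ P) < finrank K M := by
      have : Nontrivial P := hχ
      have := Submodule.finrank_quotient_add_finrank P.toSubmodule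
      have : 0 < finrank K P.toSubmodule := finrank_pos (R := K) (M := P)
      change finrank K (M ⧸ P.toSubmodule) < _
      omega
    have hvQ : (toEnd K L (M ⧸ P) x).HasEigenvector μ (LieSubmodule.Quotient.mk' P v) := by
      refine ⟨Module.End.mem_eigenspace_iff.mpr ?_, by simpa using hvP⟩
      rw [toEnd_apply_apply, ← LieModuleHom.map_lie, ← toEnd_apply_apply K, hv.apply_eq_smul,
        map_smul]
    obtain ⟨ψ, hψx, hψ⟩ := exists_lieCharacter_apply_eq_of_hasEigenvalue
      (Module.End.hasEigenvalue_of_hasEigenvector hvQ)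
    refine ⟨ψ, hψx, fun y ↦ hasEigenvalue_of_surjective_intertwiner
      (π := (LieSubmodule.Quotient.mk' P : M →ₗ[K] M ⧸ P)) ?_
      (LieSubmodule.Quotient.surjective_mk' P) (hψ y)⟩
    ext z
    simp
termination_by finrank K M

end Characters

section Nilpotent

variable {K L : Type*} [Field K] [LieRing L] [LieAlgebra K L] [FiniteDimensional K L]

theorem isNilpotent_ad_of_mem_isNilpotent_lieIdeal (I : LieIdeal K L) [LieRing.IsNilpotent I]
    {x : L} (hx : x ∈ I) : IsNilpotent (LieAlgebra.ad K L x) := by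
  obtain ⟨k, hk⟩ := (LieAlgebra.isNilpotent_iff_forall (R := K)).mp ‹LieRing.IsNilpotent I› ⟨x, hx⟩
  have hincl : (LieAlgebra.ad K L x ^ k) ∘ₗ (I.incl : I →ₗ[K] L) =
      I.incl ∘ₗ (LieAlgebra.ad K I ⟨x, hx⟩ ^ k) :=
    Module.End.commute_pow_left_of_commute (g := LieAlgebra.ad K I ⟨x, hx⟩)
      (g₂ := LieAlgebra.ad K L x) (LinearMap.ext fun _ ↦ rfl) k
  refine ⟨k + 1, LinearMap.ext fun y ↦ ?_⟩
  have hxy : (LieAlgebra.ad K L x ^ k) ⁅x, y⁆ = 0 :=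
    (DFunLike.congr_fun hincl ⟨⁅x, y⁆, lie_mem_left K L I x y hx⟩).trans (by simp [hk])
  rwa [pow_succ, Module.End.mul_apply]

theorem isNilpotent_lieIdeal_of_forall_isNilpotent_ad {I : LieIdeal K L}
    (h : ∀ x ∈ I, IsNilpotent (LieAlgebra.ad K L x)) : LieRing.IsNilpotent I := by
  refine (LieAlgebra.isNilpotent_iff_forall (R := K)).mpr fun x ↦ ?_
  exact LieSubalgebra.isNilpotent_ad_of_isNilpotent_ad I.toLieSubalgebra (h x x.2)

theorem isNilpotent_iff_forall_hasEigenvalue {V : Type*} [AddCommGroup V] [Module K V]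
    [FiniteDimensional K V] [IsAlgClosed K] {f : Module.End K V} :
    IsNilpotent f ↔ ∀ μ, f.HasEigenvalue μ → μ = 0 := by
  refine ⟨fun hf μ hμ ↦ (hμ.isNilpotent_of_isNilpotent hf).eq_zero, fun h ↦ ?_⟩
  have hroots : f.charpoly.roots = Multiset.replicate f.charpoly.roots.card 0 :=
    Multiset.eq_replicate_card.mpr fun μ hμ ↦
      h μ ((f.hasEigenvalue_iff_isRoot_charpoly μ).mpr (Polynomial.isRoot_of_mem_roots hμ))
  have hcharpoly : f.charpoly = Polynomial.X ^ f.charpoly.roots.card := by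
    conv_lhs => rw [(IsAlgClosed.splits f.charpoly).eq_prod_roots_of_monic f.charpoly_monic, hroots]
    simp
  refine ⟨f.charpoly.roots.card, ?_⟩
  rw [← Polynomial.aeval_X_pow (R := K) f, ← hcharpoly, f.aeval_self_charpoly]

end Nilpotent

section Nilradical

open LieAlgebra

attribute [local instance] LieRing.ofAssociativeRing

variable {L : Type*} [LieRing L] [LieAlgebra ℂ L] [FiniteDimensional ℂ L] [IsSolvable L]

variable (L) in
theorem exists_lieIdeal_mem_iff_isNilpotent_ad :
    ∃ I : LieIdeal ℂ L, ∀ x, x ∈ I ↔ IsNilpotent (ad ℂ L x) := by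
  refine ⟨{ (⨅ χ : { χ : LieCharacter ℂ L // ∀ y, (ad ℂ L y).HasEigenvalue (χ y) },
      LinearMap.ker (χ.1 : L →ₗ[ℂ] ℂ)) with lie_mem := fun {x y} _ ↦ ?_ }, fun x ↦ ?_⟩
  · simp
  · change x ∈ ⨅ χ : { χ : LieCharacter ℂ L // ∀ y, (ad ℂ L y).HasEigenvalue (χ y) },
      LinearMap.ker (χ.1 : L →ₗ[ℂ] ℂ) ↔ _
    rw [isNilpotent_iff_forall_hasEigenvalue, Submodule.mem_iInf]
    refine ⟨fun h μ hμ ↦ ?_, fun h χ ↦ h _ (χ.2 x)⟩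
    obtain ⟨χ, rfl, hχ⟩ := exists_lieCharacter_apply_eq_of_hasEigenvalue hμ
    exact h ⟨χ, hχ⟩

theorem mem_lieNilradical_iff {x : L} : x ∈ lieNilradical L ↔ IsNilpotent (ad ℂ L x) := by
  obtain ⟨I, hI⟩ := exists_lieIdeal_mem_iff_isNilpotent_ad L
  suffices h : lieNilradical L = I by rw [h, hI]
  refine le_antisymm (sSup_le fun J hJ x hx ↦ (hI x).mpr ?_) (le_sSup ?_)
  · have : LieRing.IsNilpotent J := hJ
    exact isNilpotent_ad_of_mem_isNilpotent_lieIdeal J hx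
  · exact isNilpotent_lieIdeal_of_forall_isNilpotent_ad fun x hx ↦ (hI x).mp hx

instance isNilpotent_lieNilradical : LieRing.IsNilpotent (lieNilradical L) :=
  isNilpotent_lieIdeal_of_forall_isNilpotent_ad fun _ hx ↦ mem_lieNilradical_iff.mp hx

theorem lie_mem_lieNilradical (x y : L) : ⁅x, y⁆ ∈ lieNilradical L := by
  rw [mem_lieNilradical_iff, isNilpotent_iff_forall_hasEigenvalue]
  intro μ hμ
  obtain ⟨χ, rfl, -⟩ := exists_lieCharacter_apply_eq_of_hasEigenvalue hμ
  exact lieCharacter_apply_lie χ x y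

end Nilradical

/-! ### Derivations acting on the abelianization -/

section Abelianization

attribute [local instance] LieRing.ofAssociativeRing

variable (K N : Type*) [CommRing K] [LieRing N] [LieAlgebra K N]

/-- The abelianization `N / [N, N]` of a Lie algebra. -/
abbrev LieAbelianization : Type _ := N ⧸ ⁅(⊤ : LieIdeal K N), (⊤ : LieIdeal K N)⁆

variable {K N}

theorem derivation_apply_mem_commutator (D : LieDerivation K N N) {x : N}
    (hx : x ∈ ⁅(⊤ : LieIdeal K N), (⊤ : LieIdeal K N)⁆) :
    D x ∈ ⁅(⊤ : LieIdeal K N), (⊤ : LieIdeal K N)⁆ := by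
  rw [← LieSubmodule.mem_toSubmodule, LieSubmodule.lieIdeal_oper_eq_linear_span'] at hx
  induction hx using Submodule.span_induction with
  | mem x hx =>
    obtain ⟨a, -, b, -, rfl⟩ := hx
    rw [D.apply_lie_eq_add]
    exact add_mem (LieSubmodule.lie_mem_lie trivial trivial)
      (LieSubmodule.lie_mem_lie trivial trivial)
  | zero => rw [map_zero]; exact zero_mem _
  | add x y _ _ hx hy => rw [map_add]; exact add_mem hx hy
  | smul c x _ hx => rw [map_smul]; exact Submodule.smul_mem _ c hx

variable (K N) in
/-- The representation of the derivation algebra of `N` on the abelianization of `N`. -/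
def derivationOnAbelianization :
    LieDerivation K N N →ₗ⁅K⁆ Module.End K (LieAbelianization K N) where
  toFun D := Submodule.mapQ _ _ (D : N →ₗ[K] N) fun _ ↦ derivation_apply_mem_commutator D
  map_add' D E := Submodule.linearMap_qext _ rfl
  map_smul' c D := Submodule.linearMap_qext _ rfl
  map_lie' {D E} := Submodule.linearMap_qext _ <| LinearMap.ext fun x ↦ by
    rw [LieRing.of_associative_ring_bracket]
    simp

theorem mkQ_comp_derivation (D : LieDerivation K N N) :
    ⁅(⊤ : LieIdeal K N), (⊤ : LieIdeal K N)⁆.toSubmodule.mkQ ∘ₗ (D : N →ₗ[K] N) =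
      derivationOnAbelianization K N D ∘ₗ Submodule.mkQ _ :=
  rfl

theorem lieSubalgebra_eq_top_of_sup_commutator_eq_top [LieRing.IsNilpotent N]
    {H : LieSubalgebra K N}
    (hH : H.toSubmodule ⊔ ⁅(⊤ : LieIdeal K N), (⊤ : LieIdeal K N)⁆.toSubmodule = ⊤) : H = ⊤ := by
  have hlcs (k : ℕ) : H.toSubmodule ⊔ (LieModule.lowerCentralSeries K N N k).toSubmodule = ⊤ := by
    induction k with
    | zero => simp
    | succ k ih =>
      rw [eq_top_iff, ← hH, LieSubmodule.lieIdeal_oper_eq_linear_span', sup_le_iff,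
        Submodule.span_le]
      refine ⟨le_sup_left, ?_⟩
      rintro _ ⟨x, -, y, -, rfl⟩
      obtain ⟨a, ha, c, hc, rfl⟩ := Submodule.mem_sup.mp (ih ▸ Submodule.mem_top (x := x))
      obtain ⟨b, hb, d, hd, rfl⟩ := Submodule.mem_sup.mp (ih ▸ Submodule.mem_top (x := y))
      have hlie {z w : N} (hw : w ∈ LieModule.lowerCentralSeries K N N k) :
          ⁅z, w⁆ ∈ (LieModule.lowerCentralSeries K N N (k + 1)).toSubmodule := by
        rw [LieSubmodule.mem_toSubmodule, LieModule.lowerCentralSeries_succ]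
        exact LieSubmodule.lie_mem_lie (LieSubmodule.mem_top z) hw
      have hsplit : ⁅a + c, b + d⁆ = ⁅a, b⁆ + (⁅a + c, d⁆ - ⁅b, c⁆) := by
        rw [← lie_skew b c]
        simp only [add_lie, lie_add]
        abel
      rw [SetLike.mem_coe, hsplit]
      exact Submodule.add_mem_sup (H.lie_mem ha hb) (sub_mem (hlie hd) (hlie hc))
  obtain ⟨k, hk⟩ := LieModule.IsNilpotent.nilpotent K N N
  simpa [hk] using hlcs k

/-- The generalized kernel of a derivation, as a subalgebra. -/
def derivationGenKer (D : LieDerivation K N N) : LieSubalgebra K N where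
  __ := Module.End.maxGenEigenspace (D : N →ₗ[K] N) 0
  lie_mem' {x y} hx hy := by
    obtain ⟨k, hk⟩ := (Module.End.mem_maxGenEigenspace _ _ _).mp hx
    obtain ⟨l, hl⟩ := (Module.End.mem_maxGenEigenspace _ _ _).mp hy
    rw [zero_smul, sub_zero] at hk hl
    refine (Module.End.mem_maxGenEigenspace _ _ _).mpr ⟨k + l, ?_⟩
    rw [zero_smul, sub_zero, Module.End.pow_apply, LieDerivation.coeFn_coe,
      LieDerivation.iterate_apply_lie]
    refine Finset.sum_eq_zero fun ij hij ↦ ?_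
    simp only [← LieDerivation.coeFn_coe, ← Module.End.pow_apply]
    obtain h | h : k ≤ ij.1 ∨ l ≤ ij.2 := by
      have := Finset.HasAntidiagonal.mem_antidiagonal.mp hij
      omega
    · rw [Module.End.pow_map_zero_of_le h hk, zero_lie, smul_zero]
    · rw [Module.End.pow_map_zero_of_le h hl, lie_zero, smul_zero]

theorem mem_derivationGenKer {D : LieDerivation K N N} {x : N} :
    x ∈ derivationGenKer D ↔ ∃ k : ℕ, ((D : N →ₗ[K] N) ^ k : Module.End K N) x = 0 := by
  refine (Module.End.mem_maxGenEigenspace (D : N →ₗ[K] N) 0 x).trans ?_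
  rw [zero_smul, sub_zero]

end Abelianization

section NilpotentDerivation

variable {K N : Type*} [Field K] [LieRing N] [LieAlgebra K N] [FiniteDimensional K N]
  [LieRing.IsNilpotent N]

theorem isNilpotent_of_isNilpotent_derivationOnAbelianization {D : LieDerivation K N N}
    (hD : IsNilpotent (derivationOnAbelianization K N D)) :
    IsNilpotent (LieDerivation.toLinearMapLieHom K N D) := by
  obtain ⟨m, hm⟩ := hD
  set f : Module.End K N := LieDerivation.toLinearMapLieHom K N D
  -- Fitting decomposition: the nilpotent part is a subalgebra, the bijective one lies in `[N, N]`.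
  obtain ⟨n, hcompl, hmn⟩ :=
    (f.eventually_isCompl_ker_pow_range_pow.and (Filter.eventually_ge_atTop m)).exists
  have hrange : LinearMap.range (f ^ n) ≤ ⁅(⊤ : LieIdeal K N), (⊤ : LieIdeal K N)⁆.toSubmodule := by
    rintro _ ⟨x, rfl⟩
    have hpow := Module.End.commute_pow_left_of_commute (g₂ := derivationOnAbelianization K N D)
      (f := ⁅(⊤ : LieIdeal K N), (⊤ : LieIdeal K N)⁆.toSubmodule.mkQ) (g := f)
      (mkQ_comp_derivation D).symm n
    rw [LieSubmodule.mem_toSubmodule, ← LieSubmodule.Quotient.mk_eq_zero]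
    exact (DFunLike.congr_fun hpow x).symm.trans (by simp [pow_eq_zero_of_le hmn hm])
  have htop : derivationGenKer D = ⊤ := by
    refine lieSubalgebra_eq_top_of_sup_commutator_eq_top (eq_top_iff.mpr ?_)
    rw [← hcompl.sup_eq_top]
    exact sup_le_sup (fun x hx ↦ mem_derivationGenKer.mpr ⟨n, hx⟩) hrange
  exact Module.End.isNilpotent_iff_of_finite.mpr fun x ↦
    mem_derivationGenKer.mp (htop ▸ LieSubalgebra.mem_top x)

end NilpotentDerivation

section Action

attribute [local instance] LieRing.ofAssociativeRing

variable {K L N : Type*} [CommRing K] [LieRing L] [LieAlgebra K L] [LieRing N] [LieAlgebra K N]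
  {I : LieIdeal K L}

/-- The adjoint action of a Lie algebra on an ideal, as derivations of an algebra `N` identified
with that ideal. Allowing `N` to vary lets two Lie algebras with isomorphic ideals act on the same
algebra. -/
def idealDerivation (φ : N ≃ₗ⁅K⁆ I) : L →ₗ⁅K⁆ LieDerivation K N N where
  toFun x :=
    { toLinearMap := φ.symm.toLinearMap ∘ₗ LieModule.toEnd K L I x ∘ₗ φ.toLinearMap
      leibniz' a b := φ.injective <| Subtype.ext <| by
        have hφ (c d : N) : φ ⁅c, d⁆ = ⁅φ c, φ d⁆ := φ.toLieHom.map_lie c d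
        simp [hφ, ← lie_skew (φ b : L) ⁅x, (φ a : L)⁆] }
  map_add' x y := by ext; simp
  map_smul' c x := by ext; simp
  map_lie' {x y} := by ext; simp

theorem coe_idealDerivation_apply (φ : N ≃ₗ⁅K⁆ I) (x : L) (n : N) :
    (φ (idealDerivation φ x n) : L) = ⁅x, (φ n : L)⁆ := by
  simp [idealDerivation]

/-- The action of a Lie algebra on the abelianization of an algebra `N` identified with one of its
ideals. -/
def idealActionOnAbelianization (φ : N ≃ₗ⁅K⁆ I) :
    L →ₗ⁅K⁆ Module.End K (LieAbelianization K N) :=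
  (derivationOnAbelianization K N).comp (idealDerivation φ)

theorem idealActionOnAbelianization_eq_zero_of_mem (φ : N ≃ₗ⁅K⁆ I) {x : L} (hx : x ∈ I) :
    idealActionOnAbelianization φ x = 0 := by
  refine Submodule.linearMap_qext _ (LinearMap.ext fun n ↦ ?_)
  refine (LieSubmodule.Quotient.mk_eq_zero _).mpr ?_
  have hinner : idealDerivation φ x n = ⁅φ.symm ⟨x, hx⟩, n⁆ := by
    refine φ.injective (Subtype.ext ?_)
    simp [coe_idealDerivation_apply]
  change idealDerivation φ x n ∈ _
  rw [hinner]
  exact LieSubmodule.lie_mem_lie trivial trivial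

end Action

section NilradicalAction

attribute [local instance] LieRing.ofAssociativeRing

variable {L N : Type*} [LieRing L] [LieAlgebra ℂ L] [FiniteDimensional ℂ L]
  [LieAlgebra.IsSolvable L] [LieRing N] [LieAlgebra ℂ N] (φ : N ≃ₗ⁅ℂ⁆ lieNilradical L)

theorem commute_idealActionOnAbelianization (x y : L) :
    Commute (idealActionOnAbelianization φ x) (idealActionOnAbelianization φ y) := by
  rw [commute_iff_lie_eq, ← LieHom.map_lie,
    idealActionOnAbelianization_eq_zero_of_mem φ (lie_mem_lieNilradical x y)]

theorem mem_lieNilradical_of_isNilpotent_idealActionOnAbelianization {x : L}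
    (hx : IsNilpotent (idealActionOnAbelianization φ x)) : x ∈ lieNilradical L := by
  have : LieRing.IsNilpotent N := φ.nilpotent_iff_equiv_nilpotent.mpr inferInstance
  have : FiniteDimensional ℂ N := φ.symm.toLinearEquiv.finiteDimensional
  set f := LieDerivation.toLinearMapLieHom ℂ N (idealDerivation φ x)
  obtain ⟨k, hk⟩ : IsNilpotent f := isNilpotent_of_isNilpotent_derivationOnAbelianization hx
  have hpow := Module.End.commute_pow_left_of_commute (g₂ := LieAlgebra.ad ℂ L x) (g := f)
    (f := ((lieNilradical L).incl : lieNilradical L →ₗ[ℂ] L) ∘ₗ φ.toLinearEquiv.toLinearMap)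
    (LinearMap.ext fun n ↦ (coe_idealDerivation_apply φ x n).symm) k
  rw [hk, LinearMap.comp_zero] at hpow
  refine mem_lieNilradical_iff.mpr ⟨k + 1, LinearMap.ext fun y ↦ ?_⟩
  obtain ⟨n, hn⟩ := φ.surjective ⟨⁅x, y⁆, lie_mem_lieNilradical x y⟩
  have hxy : (φ n : L) = ⁅x, y⁆ := congrArg Subtype.val hn
  rw [pow_succ, Module.End.mul_apply, LieAlgebra.ad_apply, ← hxy]
  exact DFunLike.congr_fun hpow n

theorem ker_idealActionOnAbelianization :
    LinearMap.ker (idealActionOnAbelianization φ).toLinearMap = (lieNilradical L).toSubmodule := by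
  ext x
  refine ⟨fun hx ↦ ?_, fun hx ↦ idealActionOnAbelianization_eq_zero_of_mem φ hx⟩
  refine mem_lieNilradical_of_isNilpotent_idealActionOnAbelianization φ ?_
  exact (LinearMap.mem_ker.mp hx) ▸ IsNilpotent.zero

theorem finrank_range_idealActionOnAbelianization {Q : Submodule ℂ L}
    (hQ : IsCompl (lieNilradical L).toSubmodule Q) :
    Module.finrank ℂ (LinearMap.range (idealActionOnAbelianization φ).toLinearMap) =
      Module.finrank ℂ Q := by
  have hrank := LinearMap.finrank_range_add_finrank_ker
    (idealActionOnAbelianization φ).toLinearMap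
  have hcompl := Submodule.finrank_add_eq_of_isCompl hQ
  rw [ker_idealActionOnAbelianization] at hrank
  omega

end NilradicalAction

/-! ### Spaces of endomorphisms containing the diagonal ones -/

section LineProjections

variable {K V ι : Type*} [CommRing K] [AddCommGroup V] [Module K V]

/-- The projection of `V` onto the line spanned by a basis vector, along the span of the remaining
ones. -/
noncomputable def basisProj (b : Module.Basis ι K V) (i : ι) : Module.End K V :=
  (b.coord i).smulRight (b i)

theorem basisProj_apply (b : Module.Basis ι K V) (i : ι) (v : V) :
    basisProj b i v = b.coord i v • b i :=
  rfl

theorem basisProj_self (b : Module.Basis ι K V) (i : ι) : basisProj b i (b i) = b i := by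
  simp [basisProj_apply]

theorem basisProj_of_ne (b : Module.Basis ι K V) {i j : ι} (h : j ≠ i) :
    basisProj b i (b j) = 0 := by
  simp [basisProj_apply, h]

theorem basisProj_mul_mul_basisProj (b : Module.Basis ι K V) (i : ι) (f : Module.End K V) (j : ι) :
    basisProj b i * f * basisProj b j = b.coord i (f (b j)) • (b.coord j).smulRight (b i) := by
  ext v
  simp [basisProj_apply, smul_smul, mul_comm]

theorem completeOrthogonalIdempotents_basisProj [Fintype ι] (b : Module.Basis ι K V) :
    CompleteOrthogonalIdempotents (basisProj b) where
  idem i := b.ext fun j ↦ by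
    rcases eq_or_ne j i with rfl | h <;> simp [basisProj_self, basisProj_of_ne, *]
  ortho i j hij := b.ext fun k ↦ by
    rcases eq_or_ne k j with rfl | h <;> simp [basisProj_self, basisProj_of_ne, hij.symm, *]
  complete := LinearMap.ext fun v ↦ by simp [LinearMap.sum_apply, basisProj_apply, b.sum_repr]

theorem basisProj_reindex {κ : Type*} (b : Module.Basis ι K V) (e : ι ≃ κ) (i : κ) :
    basisProj (b.reindex e) i = basisProj b (e.symm i) := by
  ext v
  simp [basisProj_apply]

end LineProjections

section CommutingFamilies

open LieModule Module

attribute [local instance] LieRing.ofAssociativeRing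

variable {K V : Type*} [Field K] [IsAlgClosed K] [AddCommGroup V] [Module K V]
  [FiniteDimensional K V] {U : LieSubalgebra K (Module.End K V)} [IsLieAbelian U]

theorem isNilpotent_of_forall_weight_apply_eq_zero {u : U} (hu : ∀ χ : Weight K U V, χ u = 0) :
    IsNilpotent (u : Module.End K V) := by
  have htop : (u : Module.End K V).maxGenEigenspace 0 = ⊤ := by
    rw [eq_top_iff, ← LieSubmodule.top_toSubmodule (R := K) (L := U), ← iSup_genWeightSpace_eq_top',
      LieSubmodule.iSup_toSubmodule]
    exact iSup_le fun χ ↦ hu χ ▸ genWeightSpace_le_genWeightSpaceOf V u χ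
  refine Module.End.isNilpotent_iff_of_finite.mpr fun v ↦ ?_
  obtain ⟨k, hk⟩ :=
    (Module.End.mem_maxGenEigenspace _ _ _).mp (htop ▸ Submodule.mem_top (x := v))
  exact ⟨k, by simpa using hk⟩

theorem exists_basis_forall_basisProj_mem
    (hnil : ∀ u ∈ U, IsNilpotent u → u = 0) (hdim : finrank K V ≤ finrank K U) :
    ∃ b : Basis (Fin (finrank K V)) K V, ∀ i, basisProj b i ∈ U := by
  choose v hv0 hv using exists_forall_lie_eq_smul K U V
  have hind : LinearIndependent K v :=
    (LieSubmodule.iSupIndep_toSubmodule.mpr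
      (iSupIndep_genWeightSpace' K U V)).linearIndependent _
      (fun χ ↦ weightSpace_le_genWeightSpace V χ ((mem_weightSpace χ _).mpr (hv χ))) hv0
  let ev : U →ₗ[K] Weight K U V → K := LinearMap.pi (Weight.toLinear K U V)
  have hinj : Function.Injective ev := by
    refine (injective_iff_map_eq_zero ev).mpr fun u hu ↦ Subtype.ext ?_
    exact hnil u u.2 (isNilpotent_of_forall_weight_apply_eq_zero fun χ ↦ congrFun hu χ)
  have hle : finrank K U ≤ Fintype.card (Weight K U V) := by
    simpa using LinearMap.finrank_le_finrank_of_injective hinj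
  have hcard : Fintype.card (Weight K U V) = finrank K V :=
    hind.fintype_card_le_finrank.antisymm (hdim.trans hle)
  have hsurj : Function.Surjective ev := by
    refine (LinearMap.injective_iff_surjective_of_finrank_eq_finrank ?_).mp hinj
    rw [finrank_fintype_fun_eq_card]
    exact hle.antisymm (hcard.trans_le hdim)
  let b := basisOfLinearIndependentOfCardEqFinrank' v hind hcard
  refine ⟨b.reindex (Fintype.equivFinOfCardEq hcard), fun i ↦ ?_⟩
  rw [basisProj_reindex]
  set χ := (Fintype.equivFinOfCardEq hcard).symm i
  classical
  obtain ⟨u, hu⟩ := hsurj (Pi.single χ 1)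
  suffices basisProj b χ = u from this ▸ u.2
  refine b.ext fun ψ ↦ ?_
  have huψ : (u : Module.End K V) (b ψ) = (Pi.single χ 1 : Weight K U V → K) ψ • b ψ := by
    rw [coe_basisOfLinearIndependentOfCardEqFinrank', ← congrFun hu ψ]
    exact hv ψ u
  rcases eq_or_ne ψ χ with rfl | h
  · rw [huψ, basisProj_self, Pi.single_eq_same, one_smul]
  · rw [huψ, basisProj_of_ne b h, Pi.single_eq_of_ne h, zero_smul]

end CommutingFamilies

section CommutatorClosed

attribute [local instance] LieRing.ofAssociativeRing

variable {K A ι : Type*} [CommRing K] [Invertible (2 : K)] [Ring A] [Algebra K A]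
  {G : LieSubalgebra K A} {p : ι → A}

theorem mul_mul_mem_of_orthogonalIdempotents (hp : OrthogonalIdempotents p) (hpG : ∀ i, p i ∈ G)
    {i j : ι} (hij : i ≠ j) {x : A} (hx : x ∈ G) : p i * x * p j ∈ G := by
  have hi : p i * p i = p i := hp.idem i
  have hij₀ : p i * p j = 0 := hp.ortho hij
  have hji₀ : p j * p i = 0 := hp.ortho hij.symm
  have hsum : ⁅⁅p i, x⁆, p j⁆ = p i * x * p j + p j * x * p i := by
    calc ⁅⁅p i, x⁆, p j⁆ = p i * x * p j - x * (p i * p j) - p j * p i * x + p j * x * p i := by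
          simp only [LieRing.of_associative_ring_bracket]
          noncomm_ring
      _ = _ := by simp [hij₀, hji₀]
  have hdiff : ⁅p i, ⁅⁅p i, x⁆, p j⁆⁆ = p i * x * p j - p j * x * p i := by
    calc ⁅p i, ⁅⁅p i, x⁆, p j⁆⁆ = p i * p i * x * p j + p i * p j * x * p i
          - p i * x * (p j * p i) - p j * x * (p i * p i) := by
          rw [hsum, LieRing.of_associative_ring_bracket]
          noncomm_ring
      _ = _ := by simp [hi, hij₀, hji₀]
  have hmem : ⁅⁅p i, x⁆, p j⁆ ∈ G := G.lie_mem (G.lie_mem (hpG i) hx) (hpG j)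
  have htwo : (2 : K) • (p i * x * p j) ∈ G := by
    have hadd : (2 : K) • (p i * x * p j) = ⁅⁅p i, x⁆, p j⁆ + ⁅p i, ⁅⁅p i, x⁆, p j⁆⁆ := by
      rw [hdiff, hsum, add_add_sub_cancel, two_smul]
    exact hadd ▸ G.add_mem hmem (G.lie_mem (hpG i) hmem)
  exact (G.toSubmodule.smul_mem_iff_of_isUnit (isUnit_of_invertible 2)).mp htwo

theorem mul_mem_of_completeOrthogonalIdempotents [Fintype ι] (hp : CompleteOrthogonalIdempotents p)
    (hpG : ∀ i, p i ∈ G) (hcorner : ∀ i x, p i * x * p i ∈ K ∙ p i) {x y : A} (hx : x ∈ G)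
    (hy : y ∈ G) : x * y ∈ G := by
  have hdiag (i : ι) (z : A) : p i * z * p i ∈ G := by
    obtain ⟨c, hc⟩ := Submodule.mem_span_singleton.mp (hcorner i z)
    exact hc ▸ G.smul_mem c (hpG i)
  have hentry {z : A} (hz : z ∈ G) (i j : ι) : p i * z * p j ∈ G := by
    rcases eq_or_ne i j with rfl | hij
    · exact hdiag i z
    · exact mul_mul_mem_of_orthogonalIdempotents hp.toOrthogonalIdempotents hpG hij hz
  have hexpand : x * y = ∑ i, ∑ k, ∑ j, p i * x * p j * (p j * y * p k) := by
    have hinner (i k : ι) : ∑ j, p i * x * p j * (p j * y * p k) = p i * (x * y) * p k := by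
      calc _ = ∑ j, p i * x * p j * (y * p k) := Finset.sum_congr rfl fun j _ ↦ by
            simp only [mul_assoc, ← mul_assoc (p j) (p j), (hp.idem j).eq]
        _ = _ := by simp only [← Finset.sum_mul, ← Finset.mul_sum, hp.complete, one_mul, mul_assoc]
    simp_rw [hinner, ← Finset.mul_sum, ← Finset.sum_mul, hp.complete, mul_one, one_mul]
  rw [hexpand]
  refine sum_mem fun i _ ↦ sum_mem fun k _ ↦ sum_mem fun j _ ↦ ?_
  rcases eq_or_ne i k with rfl | hik
  · simpa only [mul_assoc] using hdiag i (x * p j * (p j * y))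
  · have hlie : ⁅p i * x * p j, p j * y * p k⁆ = p i * x * p j * (p j * y * p k) := by
      rw [LieRing.of_associative_ring_bracket, sub_eq_self]
      calc _ = p j * y * (p k * p i) * x * p j := by simp only [mul_assoc]
        _ = 0 := by simp [hp.ortho hik.symm]
    exact hlie ▸ G.lie_mem (hentry hx i j) (hentry hy j k)

theorem exists_subalgebra_coe_eq_of_basisProj_mem {V : Type*} [AddCommGroup V] [Module K V]
    [Finite ι] (b : Module.Basis ι K V) {G : LieSubalgebra K (Module.End K V)}
    (hb : ∀ i, basisProj b i ∈ G) :
    ∃ A : Subalgebra K (Module.End K V), (A : Set (Module.End K V)) = G := by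
  have := Fintype.ofFinite ι
  have hp := completeOrthogonalIdempotents_basisProj b
  have hcorner (i : ι) (f : Module.End K V) :
      basisProj b i * f * basisProj b i ∈ K ∙ basisProj b i :=
    Submodule.mem_span_singleton.mpr ⟨_, (basisProj_mul_mul_basisProj b i f i).symm⟩
  have hone : (1 : Module.End K V) ∈ G := hp.complete ▸ sum_mem fun i _ ↦ hb i
  exact ⟨G.toSubmodule.toSubalgebra hone fun _ _ hf hg ↦
    mul_mem_of_completeOrthogonalIdempotents hp hb hcorner hf hg, rfl⟩

end CommutatorClosed

section Centralizer

open Module Polynomial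

variable {K V ι : Type*} [Field K] [AddCommGroup V] [Module K V] [FiniteDimensional K V]
  {t : Module.End K V}

variable (t) in
theorem exists_mem_adjoin_eigenspace_projection (μ : K) :
    ∃ P ∈ Algebra.adjoin K {t}, (∀ v ∈ t.eigenspace μ, P v = v) ∧
      ∀ ν ≠ μ, ∀ v ∈ t.eigenspace ν, P v = 0 := by
  classical
  let s : Finset K := insert μ t.finite_hasEigenvalue.toFinset
  have hs : Set.InjOn (id : K → K) s := Function.injective_id.injOn
  refine ⟨aeval t (Lagrange.basis s id μ), aeval_mem_adjoin_singleton K t, fun v hv ↦ ?_,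
    fun ν hν v hv ↦ ?_⟩
  · rw [Module.End.aeval_apply_of_mem_apply_eq_smul (Module.End.mem_eigenspace_iff.mp hv),
      show (Lagrange.basis s id μ).eval μ = 1 from
        Lagrange.eval_basis_self hs (Finset.mem_insert_self _ _), one_smul]
  · by_cases hv0 : v = 0
    · rw [hv0, map_zero]
    have hνs : ν ∈ s := Finset.mem_insert_of_mem <| (Set.Finite.mem_toFinset _).mpr <|
      Module.End.hasEigenvalue_of_hasEigenvector ⟨hv, hv0⟩
    rw [Module.End.aeval_apply_of_mem_apply_eq_smul (Module.End.mem_eigenspace_iff.mp hv),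
      show (Lagrange.basis s id μ).eval ν = 0 from Lagrange.eval_basis_of_ne (v := id) hν.symm hνs,
      zero_smul]

theorem card_eigenvalues_le_finrank_adjoin :
    Fintype.card t.Eigenvalues ≤ finrank K (Algebra.adjoin K {t}) := by
  choose P hPadj hPself hPne using exists_mem_adjoin_eigenspace_projection t
  choose v hv using fun μ : t.Eigenvalues ↦ Module.End.HasEigenvalue.exists_hasEigenvector μ.2
  let ev : Algebra.adjoin K {t} →ₗ[K] V :=
    LinearMap.applyₗ (∑ μ, v μ) ∘ₗ (Algebra.adjoin K {t}).val.toLinearMap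
  have hev (μ : t.Eigenvalues) : ev ⟨P μ, hPadj μ⟩ = v μ := by
    change P μ (∑ ν, v ν) = v μ
    rw [map_sum, Finset.sum_eq_single_of_mem μ (Finset.mem_univ μ), hPself μ _ (hv μ).1]
    exact fun ν _ hν ↦ hPne μ ν (Subtype.coe_ne_coe.mpr hν) _ (hv ν).1
  refine LinearIndependent.fintype_card_le_finrank (.of_comp ev ?_)
    (b := fun μ : t.Eigenvalues ↦ (⟨P μ, hPadj μ⟩ : Algebra.adjoin K {t}))
  rw [show ev ∘ _ = v from funext hev]
  exact Module.End.eigenvectors_linearIndependent' t _ Subtype.val_injective v hv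

theorem finrank_le_card_eigenvalues [IsAlgClosed K] (ht : t.IsSemisimple)
    (h : ∀ μ, ∃ w, t.eigenspace μ ≤ K ∙ w) : finrank K V ≤ Fintype.card t.Eigenvalues := by
  choose w hw using h
  have hspan : Submodule.span K (Set.range fun μ : t.Eigenvalues ↦ w μ) = ⊤ := by
    rw [eq_top_iff, ← ht.iSup_eigenspace_eq_top, iSup_le_iff]
    intro μ
    by_cases hμ : t.HasEigenvalue μ
    · exact (hw μ).trans <| Submodule.span_mono <|
        Set.singleton_subset_iff.mpr ⟨(⟨μ, hμ⟩ : t.Eigenvalues), rfl⟩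
    · exact (not_ne_iff.mp hμ).trans_le bot_le
  rw [← finrank_top K V, ← hspan]
  exact finrank_range_le_card _

theorem mul_eq_smul_of_eigenspace_projection [IsAlgClosed K] (ht : t.IsSemisimple)
    {P : Module.End K V} {μ : K} (hself : ∀ v ∈ t.eigenspace μ, P v = v)
    (hne : ∀ ν ≠ μ, ∀ v ∈ t.eigenspace ν, P v = 0) : t * P = μ • P := by
  refine linearMap_ext_of_iSup_eq_top ht.iSup_eigenspace_eq_top fun ν v hv ↦ ?_
  rcases eq_or_ne ν μ with rfl | hν
  · simp [hself v hv, Module.End.mem_eigenspace_iff.mp hv]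
  · simp [hne ν hν v hv]

theorem exists_eigenspace_le_span_singleton [IsAlgClosed K] (b : Basis ι K V)
    {A : Subalgebra K (Module.End K V)} (hbA : ∀ i, basisProj b i ∈ A) (htA : t ∈ A)
    (ht : t.IsSemisimple)
    (hcent : ∀ f ∈ A, Commute f t → f ∈ Algebra.adjoin K {t}) (μ : K) :
    ∃ w, t.eigenspace μ ≤ K ∙ w := by
  obtain ⟨P, hPadj, hPself, hPne⟩ := exists_mem_adjoin_eigenspace_projection t μ
  have hPA : P ∈ A := Algebra.adjoin_le (Set.singleton_subset_iff.mpr htA) hPadj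
  have htP : t * P = μ • P := mul_eq_smul_of_eigenspace_projection ht hPself hPne
  have hPt : P * t = μ • P := (Algebra.commute_of_mem_adjoin_self hPadj).eq ▸ htP
  -- `P * basisProj b i * P` is a polynomial in `t`, hence scalar on the eigenspace, but has rank at
  -- most one; if all these scalars vanish then so does `P`.
  have hscalar (i : ι) : ∃ c : K, ∀ v ∈ t.eigenspace μ, b.coord i v • P (b i) = c • v := by
    have hcomm : Commute (P * basisProj b i * P) t := by
      rw [commute_iff_eq, mul_assoc, hPt, ← mul_assoc t, ← mul_assoc t, htP]
      simp only [mul_smul_comm, smul_mul_assoc]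
    have hadj := hcent _ (A.mul_mem (A.mul_mem hPA (hbA i)) hPA) hcomm
    rw [Algebra.adjoin_singleton_eq_range_aeval] at hadj
    obtain ⟨q, hq⟩ := hadj
    refine ⟨q.eval μ, fun v hv ↦ ?_⟩
    rw [← Module.End.aeval_apply_of_mem_apply_eq_smul (Module.End.mem_eigenspace_iff.mp hv)]
    refine .trans ?_ (LinearMap.congr_fun hq v).symm
    simp [basisProj_apply, hPself v hv]
  choose c hc using hscalar
  by_cases hc0 : ∃ i, c i ≠ 0
  · obtain ⟨i, hi⟩ := hc0
    refine ⟨P (b i), fun v hv ↦ (Submodule.smul_mem_iff _ hi).mp ?_⟩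
    exact hc i v hv ▸ Submodule.smul_mem _ _ (Submodule.mem_span_singleton_self _)
  · push Not at hc0
    refine ⟨0, fun v hv ↦ ?_⟩
    have hv0 : P v = 0 := by
      rw [← b.linearCombination_repr v, Finsupp.linearCombination_apply, map_finsuppSum]
      exact Finset.sum_eq_zero fun i _ ↦ by
        simpa [hc0 i] using hc i v hv
    rw [← hPself v hv, hv0]
    exact zero_mem _

theorem exists_commute_notMem_of_finrank_lt [IsAlgClosed K] (b : Basis ι K V)
    {A : Subalgebra K (Module.End K V)} (hbA : ∀ i, basisProj b i ∈ A) (htA : t ∈ A)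
    (ht : t.IsSemisimple) {U : Submodule K (Module.End K V)}
    (hU : ∀ f ∈ U, f ∈ Algebra.adjoin K {t}) (hdim : finrank K U < finrank K V) :
    ∃ f ∈ A, Commute f t ∧ f ∉ U := by
  by_contra! hcent
  have hadj : (Algebra.adjoin K {t}).toSubmodule ≤ U := fun f hf ↦
    hcent f (Algebra.adjoin_le (Set.singleton_subset_iff.mpr htA) hf)
      (Algebra.commute_of_mem_adjoin_self hf).symm
  have hline := exists_eigenspace_le_span_singleton b hbA htA ht
    fun f hfA hft ↦ hU f (hcent f hfA hft)
  refine hdim.not_ge ?_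
  calc finrank K V ≤ Fintype.card t.Eigenvalues := finrank_le_card_eigenvalues ht hline
    _ ≤ finrank K (Algebra.adjoin K {t}) := card_eigenvalues_le_finrank_adjoin
    _ ≤ finrank K U := Submodule.finrank_mono hadj

end Centralizer

/-! ### Cartan subalgebras and toral complements of the nilradical -/

section DiagonalEnd

open Polynomial

section Algebra

variable {K V ι : Type*} [CommSemiring K] [AddCommMonoid V] [Module K V] {W : ι → Submodule K V}
  [DecidableEq ι]

/-- The endomorphism of `V = ⨁ i, W i` acting on each `W i` as the scalar `c i`. -/
noncomputable def diagonalLinearMap (hW : DirectSum.IsInternal W) (c : ι → K) : Module.End K V :=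
  (DirectSum.toModule K ι V fun i ↦ c i • (W i).subtype) ∘ₗ
    (LinearEquiv.ofBijective (DirectSum.coeLinearMap W) hW).symm.toLinearMap

theorem diagonalLinearMap_apply_of_mem (hW : DirectSum.IsInternal W) (c : ι → K) {i : ι} {x : V}
    (hx : x ∈ W i) : diagonalLinearMap hW c x = c i • x := by
  have hsymm : (LinearEquiv.ofBijective (DirectSum.coeLinearMap W) hW).symm x =
      DirectSum.lof K ι (fun i ↦ W i) i ⟨x, hx⟩ := by
    rw [LinearEquiv.symm_apply_eq]
    exact (DirectSum.coeLinearMap_lof W i ⟨x, hx⟩).symm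
  simp [diagonalLinearMap, hsymm]

/-- The algebra of endomorphisms of `V = ⨁ i, W i` acting as a scalar on each summand. -/
noncomputable def diagonalEnd (hW : DirectSum.IsInternal W) : (ι → K) →ₐ[K] Module.End K V :=
  AlgHom.ofLinearMap
    { toFun := diagonalLinearMap hW
      map_add' c d := linearMap_ext_of_iSup_eq_top hW.submodule_iSup_eq_top fun i x hx ↦ by
        simp [diagonalLinearMap_apply_of_mem hW _ hx, add_smul]
      map_smul' a c := linearMap_ext_of_iSup_eq_top hW.submodule_iSup_eq_top fun i x hx ↦ by
        simp [diagonalLinearMap_apply_of_mem hW _ hx, mul_smul] }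
    (linearMap_ext_of_iSup_eq_top hW.submodule_iSup_eq_top fun i x hx ↦ by
      simp [diagonalLinearMap_apply_of_mem hW _ hx])
    fun c d ↦ linearMap_ext_of_iSup_eq_top hW.submodule_iSup_eq_top fun i x hx ↦ by
      simp [diagonalLinearMap_apply_of_mem hW _ hx, mul_smul, smul_comm (c i)]

theorem diagonalEnd_apply_of_mem (hW : DirectSum.IsInternal W) (c : ι → K) {i : ι} {x : V}
    (hx : x ∈ W i) : diagonalEnd hW c x = c i • x :=
  diagonalLinearMap_apply_of_mem hW c hx

end Algebra

theorem mem_adjoin_singleton_pi_of_injective {K ι : Type*} [Field K] [Finite ι] {c : ι → K}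
    (hc : Function.Injective c) (d : ι → K) : d ∈ Algebra.adjoin K {c} := by
  classical
  have := Fintype.ofFinite ι
  rw [Algebra.adjoin_singleton_eq_range_aeval]
  refine ⟨Lagrange.interpolate Finset.univ c d, funext fun i ↦ ?_⟩
  change Pi.evalAlgHom K (fun _ ↦ K) i (aeval c _) = d i
  rw [← aeval_algHom_apply, Pi.evalAlgHom_apply, coe_aeval_eq_eval]
  exact Lagrange.eval_interpolate_at_node d hc.injOn (Finset.mem_univ i)

theorem isSemisimple_diagonalEnd {K V ι : Type*} [Field K] [AddCommGroup V] [Module K V]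
    {W : ι → Submodule K V} [DecidableEq ι] [Finite ι] [FiniteDimensional K V]
    (hW : DirectSum.IsInternal W) {c : ι → K} (hc : Function.Injective c) :
    (diagonalEnd hW c).IsSemisimple := by
  have := Fintype.ofFinite ι
  refine Module.End.isSemisimple_of_squarefree_aeval_eq_zero (p := ∏ i, (X - C (c i)))
    (separable_prod_X_sub_C_iff.mpr hc).squarefree ?_
  suffices haeval : aeval c (∏ i, (X - C (c i))) = 0 by rw [aeval_algHom_apply, haeval, map_zero]
  funext i
  change Pi.evalAlgHom K (fun _ ↦ K) i (aeval c _) = 0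
  rw [← aeval_algHom_apply, Pi.evalAlgHom_apply, coe_aeval_eq_eval, eval_prod]
  exact Finset.prod_eq_zero (Finset.mem_univ i) (by simp)

end DiagonalEnd

section RootDerivation

open LieAlgebra LieModule

attribute [local instance] LieRing.ofAssociativeRing

variable {K L : Type*} [Field K] [IsAlgClosed K] [LieRing L] [LieAlgebra K L]
  [FiniteDimensional K L] (H : LieSubalgebra K L) [H.IsCartanSubalgebra]

theorem isInternal_rootSpace [DecidableEq (Weight K H L)] :
    DirectSum.IsInternal fun α : Weight K H L ↦ (rootSpace H α).toSubmodule :=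
  DirectSum.isInternal_submodule_of_iSupIndep_of_iSup_eq_top
    (LieSubmodule.iSupIndep_toSubmodule.mpr (iSupIndep_genWeightSpace' K H L)) <| by
      rw [← LieSubmodule.iSup_toSubmodule, iSup_genWeightSpace_eq_top',
        LieSubmodule.top_toSubmodule]

variable {H} in
theorem linearMap_ext_rootSpace {V : Type*} [AddCommGroup V] [Module K V] {f g : L →ₗ[K] V}
    (h : ∀ α : Weight K H L, ∀ x ∈ rootSpace H α, f x = g x) : f = g := by
  classical
  exact linearMap_ext_of_iSup_eq_top (isInternal_rootSpace H).submodule_iSup_eq_top h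

variable [CharZero K]

open Classical in
/-- The endomorphism acting on each root space `α` as the scalar `α h`: the semisimple part of
`ad h`. -/
noncomputable def rootScalarEnd : H →ₗ[K] Module.End K L :=
  (diagonalEnd (isInternal_rootSpace H)).toLinearMap ∘ₗ LinearMap.pi (Weight.toLinear K H L)

variable {H}

theorem rootScalarEnd_apply_of_mem (h : H) {α : H → K} {x : L} (hx : x ∈ rootSpace H α) :
    rootScalarEnd H h x = α h • x := by
  classical
  by_cases hα : rootSpace H α = ⊥
  · rw [hα, LieSubmodule.mem_bot] at hx
    rw [hx, map_zero, smul_zero]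
  · refine (diagonalEnd_apply_of_mem (isInternal_rootSpace H) _ (i := ⟨α, hα⟩) hx).trans ?_
    rfl

theorem rootScalarEnd_apply_lie (h : H) (x y : L) :
    rootScalarEnd H h ⁅x, y⁆ = ⁅x, rootScalarEnd H h y⁆ - ⁅y, rootScalarEnd H h x⁆ := by
  let E := rootScalarEnd H h
  let B : L →ₗ[K] L →ₗ[K] L := (toEnd K L L).toLinearMap
  suffices heq : B.compr₂ E = B.compl₂ E + B ∘ₗ E by
    rw [← lie_skew y, sub_neg_eq_add]
    exact LinearMap.congr_fun₂ heq x y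
  refine linearMap_ext_rootSpace (H := H) fun α x hx ↦
    linearMap_ext_rootSpace (H := H) fun β y hy ↦ ?_
  have hxy : ⁅x, y⁆ ∈ rootSpace H (α + β : H → K) :=
    lie_mem_genWeightSpace_of_mem_genWeightSpace hx hy
  change E ⁅x, y⁆ = ⁅x, E y⁆ + ⁅E x, y⁆
  simp only [E, rootScalarEnd_apply_of_mem h hx, rootScalarEnd_apply_of_mem h hy,
    rootScalarEnd_apply_of_mem h hxy, lie_smul, smul_lie, Pi.add_apply, add_smul, add_comm]

theorem isNilpotent_ad_sub_rootScalarEnd (h : H) :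
    IsNilpotent (ad K L (h : L) - rootScalarEnd H h) := by
  classical
  set f := ad K L (h : L) - rootScalarEnd H h
  refine Module.End.isNilpotent_iff_of_finite.mpr fun x ↦ ?_
  suffices hx : x ∈ f.maxGenEigenspace 0 by
    obtain ⟨k, hk⟩ := (Module.End.mem_maxGenEigenspace f 0 x).mp hx
    exact ⟨k, by simpa using hk⟩
  have hle : ⨆ α : Weight K H L, (rootSpace H α).toSubmodule ≤ f.maxGenEigenspace 0 := by
    refine iSup_le fun α x hx ↦ (Module.End.mem_maxGenEigenspace f 0 x).mpr ?_
    obtain ⟨k, hk⟩ := isNilpotent_toEnd_sub_algebraMap L α h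
    have hcomm (y : rootSpace H α) : f y = ⁅(h : L), (y : L)⁆ - α h • (y : L) :=
      congrArg (⁅(h : L), (y : L)⁆ - ·) (rootScalarEnd_apply_of_mem h y.2)
    have hpow := Module.End.commute_pow_left_of_commute (g₂ := f)
      (f := ((rootSpace H α).incl : rootSpace H α →ₗ[K] L))
      (g := toEnd K H (rootSpace H α) h - algebraMap K _ (α h)) (LinearMap.ext hcomm) k
    rw [hk, LinearMap.comp_zero] at hpow
    refine ⟨k, ?_⟩
    rw [zero_smul, sub_zero]
    exact DFunLike.congr_fun hpow ⟨x, hx⟩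
  exact hle ((isInternal_rootSpace H).submodule_iSup_eq_top ▸ Submodule.mem_top)

variable (H) in
theorem exists_forall_rootScalarEnd_mem_adjoin : ∃ h₀ : H, (rootScalarEnd H h₀).IsSemisimple ∧
    ∀ h, rootScalarEnd H h ∈ Algebra.adjoin K {rootScalarEnd H h₀} := by
  classical
  obtain ⟨h₀, hh₀⟩ : ∃ h₀ : H, Function.Injective fun α : Weight K H L ↦ α h₀ := by
    obtain ⟨h₀, hh₀⟩ := Module.Dual.exists_forall_ne_zero_of_forall_exists
      (fun p : {p : Weight K H L × Weight K H L // p.1 ≠ p.2} ↦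
        (Weight.toLinear K H L p.1.1 - Weight.toLinear K H L p.1.2 : Module.Dual K H)) fun p ↦ by
          by_contra! hp
          exact p.2 (Weight.ext fun h ↦ sub_eq_zero.mp (hp h))
    refine ⟨h₀, fun α β hαβ ↦ ?_⟩
    by_contra hne
    exact hh₀ ⟨(α, β), hne⟩ (sub_eq_zero.mpr hαβ)
  refine ⟨h₀, isSemisimple_diagonalEnd _ hh₀, fun h ↦ ?_⟩
  have hmem := mem_adjoin_singleton_pi_of_injective hh₀ (LinearMap.pi (Weight.toLinear K H L) h)
  exact AlgHom.map_adjoin_singleton (diagonalEnd (isInternal_rootSpace H)) _ ▸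
    Subalgebra.mem_map.mpr ⟨_, hmem, rfl⟩

end RootDerivation

section Torus

open LieAlgebra LieModule

attribute [local instance] LieRing.ofAssociativeRing

section RootScalarTorus

variable {K L : Type*} [Field K] [IsAlgClosed K] [CharZero K] [LieRing L] [LieAlgebra K L]
  [FiniteDimensional K L] {H : LieSubalgebra K L} [H.IsCartanSubalgebra]

theorem exists_ad_eq_rootScalarEnd
    (hinner : ∀ D : LieDerivation K L L, ∃ x, D = LieDerivation.ad K L x) (h : H) :
    ∃ x, ad K L x = rootScalarEnd H h := by
  obtain ⟨x, hx⟩ := hinner ⟨rootScalarEnd H h, rootScalarEnd_apply_lie h⟩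
  exact ⟨x, by rw [← LieDerivation.coe_ad_apply_eq_ad_apply, ← hx]⟩

theorem lie_eq_zero_of_ad_mem_range_rootScalarEnd {x y : L}
    (hx : ad K L x ∈ LinearMap.range (rootScalarEnd H))
    (hy : ad K L y ∈ LinearMap.range (rootScalarEnd H)) : ⁅x, y⁆ = 0 := by
  have hker {z : L} (hz : z ∈ rootSpace H (0 : H → K)) (h : H) : rootScalarEnd H h z = 0 := by
    rw [rootScalarEnd_apply_of_mem h hz, Pi.zero_apply, zero_smul]
  obtain ⟨k, hk⟩ := hy
  have hyH : y ∈ rootSpace H (0 : H → K) := by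
    refine (mem_zeroRootSubalgebra K L H y).mpr fun h ↦ ⟨1, ?_⟩
    have hh : (h : L) ∈ rootSpace H (0 : H → K) := by
      rw [rootSpace_zero_eq, LieSubalgebra.mem_toLieSubmodule]
      exact h.2
    rw [pow_one, toEnd_apply_apply]
    change ⁅(h : L), y⁆ = 0
    rw [← lie_skew, ← ad_apply K, ← hk, hker hh, neg_zero]
  obtain ⟨h, hh⟩ := hx
  rw [← ad_apply K, ← hh, hker hyH]

end RootScalarTorus

variable {L : Type*} [LieRing L] [LieAlgebra ℂ L] [FiniteDimensional ℂ L] [IsSolvable L]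

theorem sup_comap_ad_range_rootScalarEnd_eq_top {H : LieSubalgebra ℂ L} [H.IsCartanSubalgebra]
    (hE : ∀ h : H, ∃ x, ad ℂ L x = rootScalarEnd H h) :
    (lieNilradical L).toSubmodule ⊔
      (LinearMap.range (rootScalarEnd H)).comap (ad ℂ L).toLinearMap = ⊤ := by
  classical
  rw [eq_top_iff, ← (isInternal_rootSpace H).submodule_iSup_eq_top]
  refine iSup_le fun α x hx ↦ ?_
  by_cases hα : ∃ h, α h ≠ 0
  · obtain ⟨h, hh⟩ := hα
    obtain ⟨s, hs⟩ := hE h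
    have hsx : ⁅s, x⁆ = α h • x := by rw [← ad_apply ℂ, hs, rootScalarEnd_apply_of_mem h hx]
    refine Submodule.mem_sup_left (((lieNilradical L).toSubmodule.smul_mem_iff hh).mp ?_)
    exact hsx ▸ lie_mem_lieNilradical s x
  · push Not at hα
    have hα0 : (α : H → ℂ) = 0 := funext hα
    have hx : x ∈ H := by
      rwa [hα0, rootSpace_zero_eq, LieSubmodule.mem_toSubmodule,
        LieSubalgebra.mem_toLieSubmodule] at hx
    obtain ⟨s, hs⟩ := hE ⟨x, hx⟩
    have hxs : x - s ∈ lieNilradical L := by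
      rw [mem_lieNilradical_iff, map_sub, hs]
      exact isNilpotent_ad_sub_rootScalarEnd ⟨x, hx⟩
    exact Submodule.mem_sup.mpr ⟨x - s, hxs, s, ⟨⟨x, hx⟩, hs.symm⟩, sub_add_cancel x s⟩

theorem exists_torus_of_forall_inner
    (hinner : ∀ D : LieDerivation ℂ L L, ∃ x, D = LieDerivation.ad ℂ L x) :
    ∃ (t : L) (T : Submodule ℂ L), (ad ℂ L t).IsSemisimple ∧ (∀ x ∈ T, ∀ y ∈ T, ⁅x, y⁆ = 0) ∧
      (lieNilradical L).toSubmodule ⊔ T = ⊤ ∧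
        ∀ x ∈ T, ad ℂ L x ∈ Algebra.adjoin ℂ {ad ℂ L t} := by
  obtain ⟨z, _⟩ := exists_isCartanSubalgebra_engel ℂ L
  let H := LieSubalgebra.engel ℂ z
  have hE := exists_ad_eq_rootScalarEnd (H := H) hinner
  obtain ⟨h₀, hss, hadjoin⟩ := exists_forall_rootScalarEnd_mem_adjoin H
  obtain ⟨t, ht⟩ := hE h₀
  refine ⟨t, _, ht ▸ hss, fun x hx y hy ↦ lie_eq_zero_of_ad_mem_range_rootScalarEnd hx hy,
    sup_comap_ad_range_rootScalarEnd_eq_top hE, fun x hx ↦ ?_⟩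
  obtain ⟨h, hh⟩ := hx
  change rootScalarEnd H h = ad ℂ L x at hh
  rw [ht, ← hh]
  exact hadjoin h

end Torus

/-! ### Maximal rank and lifting of derivations -/

section MaximalRank

open Module

attribute [local instance] LieRing.ofAssociativeRing

variable {N : Type*} [LieRing N] [LieAlgebra ℂ N] [FiniteDimensional ℂ N]

theorem exists_basis_basisProj_mem_range_of_hasMaximalRank (hN : HasMaximalRank N) :
    ∃ b : Basis (Fin (finrank ℂ (LieAbelianization ℂ N))) ℂ (LieAbelianization ℂ N),
      ∀ i, basisProj b i ∈ (derivationOnAbelianization ℂ N).range := by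
  obtain ⟨S, _, _, _, _, ⟨φ⟩, Q, hQ, hdim⟩ := hN
  let ρ := idealActionOnAbelianization φ
  have hcomm : IsLieAbelian ρ.range := by
    refine ⟨?_⟩
    rintro ⟨_, x, rfl⟩ ⟨_, y, rfl⟩
    exact Subtype.ext (commute_iff_lie_eq.mp (commute_idealActionOnAbelianization φ x y))
  have hnil : ∀ u ∈ ρ.range, IsNilpotent u → u = 0 := by
    rintro _ ⟨x, rfl⟩ hx
    exact idealActionOnAbelianization_eq_zero_of_mem φ
      (mem_lieNilradical_of_isNilpotent_idealActionOnAbelianization φ hx)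
  have hrank : finrank ℂ (LieAbelianization ℂ N) ≤ finrank ℂ ρ.range :=
    hdim.ge.trans (finrank_range_idealActionOnAbelianization φ hQ).ge
  obtain ⟨b, hb⟩ := exists_basis_forall_basisProj_mem hnil hrank
  refine ⟨b, fun i ↦ ?_⟩
  obtain ⟨x, hx⟩ := hb i
  exact ⟨idealDerivation φ x, hx⟩

end MaximalRank

section Lifting

attribute [local instance] LieRing.ofAssociativeRing

variable {K : Type*} [Field K]

theorem exists_map_eq_and_lie_eq_zero {L L' : Type*} [LieRing L] [LieAlgebra K L] [LieRing L']
    [LieAlgebra K L'] (f : L →ₗ⁅K⁆ L') {d x : L} (hd : (LieAlgebra.ad K L d).IsSemisimple)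
    (hx : ⁅f d, f x⁆ = 0) : ∃ y, f y = f x ∧ ⁅d, y⁆ = 0 := by
  obtain ⟨W, hW, hcompl⟩ := (Module.End.isSemisimple_iff.mp hd) f.ker.toSubmodule
    fun z hz ↦ lie_mem_right K L f.ker d z hz
  obtain ⟨z, hz, y, hy, rfl⟩ := Submodule.mem_sup.mp
    (hcompl.sup_eq_top ▸ Submodule.mem_top (x := x))
  have hfy : f y = f (z + y) := by rw [map_add, show f z = 0 from hz, zero_add]
  have hker : ⁅d, y⁆ ∈ f.ker := by rw [LieHom.mem_ker, LieHom.map_lie, hfy, hx]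
  exact ⟨y, hfy, Submodule.disjoint_def.mp hcompl.disjoint _ hker (hW hy)⟩

variable [PerfectField K] {N : Type*} [LieRing N] [LieAlgebra K N] [FiniteDimensional K N]

theorem isSemisimple_ad_lieDerivation {d : LieDerivation K N N}
    (hd : Module.End.IsSemisimple (d : N →ₗ[K] N)) :
    (LieAlgebra.ad K (LieDerivation K N N) d).IsSemisimple :=
  isSemisimple_of_injective_intertwiner
    (π := (LieDerivation.toLinearMapLieHom K N).toLinearMap)
    (g := LieAlgebra.ad K (Module.End K N) d)
    (LinearMap.ext fun D ↦ (LieDerivation.toLinearMapLieHom K N).map_lie d D)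
    (LieDerivation.toLinearMapLieHom_injective K N) (LieAlgebra.ad_isSemisimple_of_isSemisimple hd)

end Lifting

section Extension

variable {K L : Type*} [CommRing K] [LieRing L] [LieAlgebra K L]

theorem exists_lieDerivation_eq_on_lieIdeal (I : LieIdeal K L) {Q : Submodule K L}
    (hQ : IsCompl I.toSubmodule Q) (hab : ∀ x ∈ Q, ∀ y ∈ Q, ⁅x, y⁆ = 0) (E : LieDerivation K I I)
    (hE : ∀ x ∈ Q, ∀ n : I, E ⁅x, n⁆ = ⁅x, E n⁆) :
    ∃ D : LieDerivation K L L, ∀ n : I, D n = E n := by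
  let F : L →ₗ[K] L :=
    I.toSubmodule.subtype ∘ₗ (E : I →ₗ[K] I) ∘ₗ Submodule.projectionOnto I.toSubmodule Q hQ
  have hFI (n : I) : F n = E n :=
    congrArg (fun m ↦ (E m : L)) (Submodule.projectionOnto_apply_left hQ n)
  have hFQ {q : L} (hq : q ∈ Q) : F q = 0 := by
    simp [F, (Submodule.projectionOnto_apply_eq_zero_iff hQ).mpr hq]
  have hFII (n m : I) : F ⁅(n : L), (m : L)⁆ = ⁅(n : L), (E m : L)⁆ - ⁅(m : L), (E n : L)⁆ :=
    (hFI ⁅n, m⁆).trans (congrArg Subtype.val (E.apply_lie_eq_sub n m))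
  have hFQI {q : L} (hq : q ∈ Q) (n : I) : F ⁅q, (n : L)⁆ = ⁅q, (E n : L)⁆ :=
    (hFI ⁅q, n⁆).trans (congrArg Subtype.val (hE q hq n))
  have hdecomp (x : L) : ∃ n : I, ∃ q ∈ Q, n + q = x := by
    obtain ⟨n, hn, q, hq, h⟩ := Submodule.mem_sup.mp
      (hQ.sup_eq_top ▸ Submodule.mem_top (x := x))
    exact ⟨⟨n, hn⟩, q, hq, h⟩
  refine ⟨⟨F, fun x y ↦ ?_⟩, hFI⟩
  obtain ⟨n, q, hq, rfl⟩ := hdecomp x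
  obtain ⟨m, p, hp, rfl⟩ := hdecomp y
  have hFIQ : F ⁅(n : L), p⁆ = -⁅p, (E n : L)⁆ := by rw [← lie_skew, map_neg, hFQI hp]
  simp only [map_add, add_lie, lie_add, hFII, hFQI hq, hFIQ, hab q hq p hp, hFI, hFQ hq, hFQ hp,
    add_zero]
  abel

end Extension

section ToralComplement

attribute [local instance] LieRing.ofAssociativeRing

variable {K L : Type*} [Field K] [LieRing L] [LieAlgebra K L]

section Identification

variable {N : Type*} [LieRing N] [LieAlgebra K N] {I : LieIdeal K L} (φ : N ≃ₗ⁅K⁆ I)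

theorem incl_comp_idealDerivation (x : L) :
    ((I.incl : I →ₗ[K] L) ∘ₗ φ.toLinearEquiv.toLinearMap) ∘ₗ (idealDerivation φ x : N →ₗ[K] N) =
      LieAlgebra.ad K L x ∘ₗ (I.incl : I →ₗ[K] L) ∘ₗ φ.toLinearEquiv.toLinearMap :=
  LinearMap.ext (coe_idealDerivation_apply φ x)

theorem isSemisimple_idealDerivation [FiniteDimensional K L] {x : L}
    (hx : (LieAlgebra.ad K L x).IsSemisimple) :
    Module.End.IsSemisimple (idealDerivation φ x : N →ₗ[K] N) :=
  isSemisimple_of_injective_intertwiner (incl_comp_idealDerivation φ x)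
    (Subtype.val_injective.comp φ.injective) hx

variable {t : L} {T : Submodule K L}

theorem idealDerivation_mem_adjoin {x : L}
    (hx : LieAlgebra.ad K L x ∈ Algebra.adjoin K {LieAlgebra.ad K L t}) :
    (idealDerivation φ x : Module.End K N) ∈
      Algebra.adjoin K {(idealDerivation φ t : Module.End K N)} :=
  mem_adjoin_singleton_of_injective_intertwiner (incl_comp_idealDerivation φ t)
    (incl_comp_idealDerivation φ x) (Subtype.val_injective.comp φ.injective) hx

theorem idealActionOnAbelianization_mem_adjoin (hsup : I.toSubmodule ⊔ T = ⊤)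
    (hT : ∀ x ∈ T, LieAlgebra.ad K L x ∈ Algebra.adjoin K {LieAlgebra.ad K L t}) (x : L) :
    idealActionOnAbelianization φ x ∈ Algebra.adjoin K {idealActionOnAbelianization φ t} := by
  obtain ⟨n, hn, y, hy, rfl⟩ := Submodule.mem_sup.mp (hsup ▸ Submodule.mem_top (x := x))
  rw [map_add, idealActionOnAbelianization_eq_zero_of_mem φ hn, zero_add]
  exact mem_adjoin_singleton_of_surjective_intertwiner (mkQ_comp_derivation _)
    (mkQ_comp_derivation _) (Submodule.mkQ_surjective _)
    (idealDerivation_mem_adjoin φ (hT y hy))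

end Identification

theorem exists_lieDerivation_eq_on_lieIdeal_of_lie_eq_zero {I : LieIdeal K L} {t : L}
    {T : Submodule K L} (hab : ∀ x ∈ T, ∀ y ∈ T, ⁅x, y⁆ = 0) (hsup : I.toSubmodule ⊔ T = ⊤)
    (hT : ∀ x ∈ T, LieAlgebra.ad K L x ∈ Algebra.adjoin K {LieAlgebra.ad K L t})
    {E : LieDerivation K I I} (hE : ⁅idealDerivation (LieEquiv.refl : I ≃ₗ⁅K⁆ I) t, E⁆ = 0) :
    ∃ D : LieDerivation K L L, ∀ n : I, D n = E n := by
  obtain ⟨Q, hQT, hQ⟩ := (codisjoint_iff.mpr hsup).symm.exists_isCompl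
  have hcomm : Commute (E : Module.End K I)
      (idealDerivation (LieEquiv.refl : I ≃ₗ⁅K⁆ I) t : Module.End K I) :=
    (commute_iff_lie_eq.mpr <| congrArg (LieDerivation.toLinearMapLieHom K I) hE).symm
  refine exists_lieDerivation_eq_on_lieIdeal I hQ.symm
    (fun x hx y hy ↦ hab x (hQT hx) y (hQT hy)) E fun x hx n ↦ ?_
  exact LinearMap.congr_fun (Algebra.commute_of_mem_adjoin_singleton_of_commute
    (idealDerivation_mem_adjoin LieEquiv.refl (hT x (hQT hx))) hcomm).eq n

end ToralComplement

section CommutingDerivation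

attribute [local instance] LieRing.ofAssociativeRing

variable {N : Type*} [LieRing N]

theorem isSemisimple_derivationOnAbelianization {K : Type*} [Field K] [LieAlgebra K N]
    [FiniteDimensional K N] {D : LieDerivation K N N}
    (hD : Module.End.IsSemisimple (D : N →ₗ[K] N)) :
    (derivationOnAbelianization K N D).IsSemisimple :=
  isSemisimple_of_surjective_intertwiner (mkQ_comp_derivation D)
    (Submodule.mkQ_surjective _) hD

theorem exists_lie_eq_zero_notMem_of_hasMaximalRank [LieAlgebra ℂ N] [FiniteDimensional ℂ N]
    (hN : HasMaximalRank N) {d : LieDerivation ℂ N N}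
    (hd : Module.End.IsSemisimple (d : N →ₗ[ℂ] N))
    {U : Submodule ℂ (Module.End ℂ (LieAbelianization ℂ N))}
    (hU : ∀ f ∈ U, f ∈ Algebra.adjoin ℂ {derivationOnAbelianization ℂ N d})
    (hdim : Module.finrank ℂ U < dimModSquare N) :
    ∃ E : LieDerivation ℂ N N, ⁅d, E⁆ = 0 ∧ derivationOnAbelianization ℂ N E ∉ U := by
  obtain ⟨b, hb⟩ := exists_basis_basisProj_mem_range_of_hasMaximalRank hN
  obtain ⟨A, hA⟩ := exists_subalgebra_coe_eq_of_basisProj_mem b hb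
  obtain ⟨f, hfA, hfd, hfU⟩ := exists_commute_notMem_of_finrank_lt b (fun i ↦ hA.ge (hb i))
    (hA.ge ⟨d, rfl⟩) (isSemisimple_derivationOnAbelianization hd) hU hdim
  obtain ⟨D, rfl⟩ := hA.le hfA
  obtain ⟨E, hE, hdE⟩ := exists_map_eq_and_lie_eq_zero (derivationOnAbelianization ℂ N)
    (isSemisimple_ad_lieDerivation hd) (commute_iff_lie_eq.mp hfd.symm)
  exact ⟨E, hdE, hE ▸ hfU⟩

end CommutingDerivation

theorem mainTheorem1 (R : Type u) [LieRing R] [LieAlgebra ℂ R] [FiniteDimensional ℂ R]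
    [LieAlgebra.IsSolvable R] (hN : HasMaximalRank.{u, v} (lieNilradical R))
    (Q : Submodule ℂ R) (hQ : IsCompl (lieNilradical R).toSubmodule Q)
    (hdim : Module.finrank ℂ Q < dimModSquare (lieNilradical R)) :
    ∃ D : LieDerivation ℂ R R, ∀ x : R, D ≠ LieDerivation.ad ℂ R x := by
  by_contra! hinner
  let φ : lieNilradical R ≃ₗ⁅ℂ⁆ lieNilradical R := LieEquiv.refl
  have : FiniteDimensional ℂ (lieNilradical R) := φ.toLinearEquiv.finiteDimensional
  obtain ⟨t, T, ht, hab, hsup, hT⟩ := exists_torus_of_forall_inner hinner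
  obtain ⟨E, htE, hE⟩ := exists_lie_eq_zero_notMem_of_hasMaximalRank hN
    (isSemisimple_idealDerivation φ ht)
    (by rintro _ ⟨x, rfl⟩; exact idealActionOnAbelianization_mem_adjoin φ hsup hT x)
    ((finrank_range_idealActionOnAbelianization φ hQ).trans_lt hdim)
  obtain ⟨D, hD⟩ := exists_lieDerivation_eq_on_lieIdeal_of_lie_eq_zero hab hsup hT htE
  obtain ⟨x, rfl⟩ := hinner D
  have hEx : idealDerivation φ x = E := LieDerivation.ext fun n ↦ Subtype.ext <|
    (coe_idealDerivation_apply φ x n).trans (hD n ▸ (LieDerivation.ad_apply_apply ℂ R x n).symm)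
  exact hE ⟨x, congrArg (derivationOnAbelianization ℂ _) hEx⟩
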